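/- Let $n\ge 0$ and let $M$ be a smooth $n$-dimensional manifold (Hausdorff, second countable, without boundary). Let $x\colon M\to\mathbb C^{n}\cong\mathbb R^{2n}$ be a smooth immersion, and give $M$ the induced metric $g(v,w)=\langle dx(v),dx(w)\rangle$. Let $h$ be the second fundamental form of $x$ (with values in the normal bundle), $\vec H=\operatorname{tr}_g h$ its mean curvature vector, and $x^{\top}$, $x^{\perp}$ the tangential and normal parts of the position vector; regard $x^\top$ as a tangent vector field on $M$. Suppose that $x$ is a self-expander, that is, $\vec H=x^{\perp}$; that $(M,g)$ is complete; and that the squared norm $|h|^2$ of the second fundamental form is equal to a constant $S$ on $M$. Then the Bakry–Émery Ricci tensor $$\mathrm{Ric}_{x^{\top}}=\mathrm{Ric}-\tfrac12 L_{x^{\top}}g ,$$ where $\mathrm{Ric}$ is the Ricci tensor of $g$ and $L_{x^\top}g$ is the Lie derivative of $g$ along $x^\top$, is bounded below by $-(S+1)$: for every $p\in M$ and every $v\in T_pM$, $$\mathrm{Ric}_{x^{\top}}(v,v)\ \ge\ -(S+1)\,g(v,v).$$ -/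

import Mathlib

open scoped Manifold ContDiff Topology

noncomputable section

/-! ## Tensor calculus in coordinates on `ℝⁿ`

A metric near a point of `ℝⁿ` is given by its matrix-valued coefficient function `G = (g_{ij})`. -/

namespace CoordGeom

/-- The partial derivative `∂ᵢ f` at `u`. -/
def partialD {n : ℕ} {F : Type*} [NormedAddCommGroup F] [NormedSpace ℝ F]
    (i : Fin n) (f : EuclideanSpace ℝ (Fin n) → F) (u : EuclideanSpace ℝ (Fin n)) : F :=
  fderiv ℝ f u (EuclideanSpace.single i (1 : ℝ))

/-- The Christoffel symbol
`Γᵏᵢⱼ = ½ ∑ₗ gᵏˡ (∂ᵢ gⱼₗ + ∂ⱼ gᵢₗ - ∂ₗ gᵢⱼ)` of the Levi-Civita connection, so that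
`∇_{∂ᵢ} ∂ⱼ = ∑ₖ Γᵏᵢⱼ ∂ₖ`. -/
def christoffel {n : ℕ} (G : EuclideanSpace ℝ (Fin n) → Matrix (Fin n) (Fin n) ℝ)
    (k i j : Fin n) (u : EuclideanSpace ℝ (Fin n)) : ℝ :=
  (1 / 2 : ℝ) * ∑ l, (G u)⁻¹ k l *
    (partialD i (fun w => G w j l) u + partialD j (fun w => G w i l) u
      - partialD l (fun w => G w i j) u)

/-- The component `Rˡₖᵢⱼ` of the curvature tensor
`R(X, Y)Z = ∇_X ∇_Y Z - ∇_Y ∇_X Z - ∇_{[X, Y]} Z`, that is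
`R(∂ᵢ, ∂ⱼ)∂ₖ = ∑ₗ Rˡₖᵢⱼ ∂ₗ`. -/
def riemann {n : ℕ} (G : EuclideanSpace ℝ (Fin n) → Matrix (Fin n) (Fin n) ℝ)
    (l k i j : Fin n) (u : EuclideanSpace ℝ (Fin n)) : ℝ :=
  partialD i (christoffel G l j k) u - partialD j (christoffel G l i k) u
    + ∑ m, (christoffel G l i m u * christoffel G m j k u
      - christoffel G l j m u * christoffel G m i k u)

/-- The component `Ricⱼₖ = ∑ᵢ Rⁱₖᵢⱼ` of the Ricci tensor `Ric(Y, Z) = tr (X ↦ R(X, Y)Z)`. -/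
def ricci {n : ℕ} (G : EuclideanSpace ℝ (Fin n) → Matrix (Fin n) (Fin n) ℝ)
    (j k : Fin n) (u : EuclideanSpace ℝ (Fin n)) : ℝ :=
  ∑ i, riemann G i k i j u

/-- The component
`(L_V g)ᵢⱼ = ∑ₖ (Vᵏ ∂ₖ gᵢⱼ + gₖⱼ ∂ᵢ Vᵏ + gᵢₖ ∂ⱼ Vᵏ)` of the Lie derivative of the metric, i.e.
`(L_V g)(X, Y) = V (g(X, Y)) - g([V, X], Y) - g(X, [V, Y])` for `X = ∂ᵢ`, `Y = ∂ⱼ`. -/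
def lieDerivMetric {n : ℕ} (G : EuclideanSpace ℝ (Fin n) → Matrix (Fin n) (Fin n) ℝ)
    (V : EuclideanSpace ℝ (Fin n) → EuclideanSpace ℝ (Fin n))
    (i j : Fin n) (u : EuclideanSpace ℝ (Fin n)) : ℝ :=
  ∑ k, (V u k * partialD k (fun w => G w i j) u
    + G u k j * partialD i (fun w => V w k) u
    + G u i k * partialD j (fun w => V w k) u)

end CoordGeom

/-! ## Riemannian metrics on a manifold, read in the preferred chart at a point

All tensors below are evaluated at `p` from their components in the chart `extChartAt p` at `p`. -/

namespace RiemGeom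

open CoordGeom

/-- A field of (bilinear) forms on the tangent spaces of the `n`-manifold `M`. -/
abbrev FormField (n : ℕ) (M : Type*) [TopologicalSpace M]
    [ChartedSpace (EuclideanSpace ℝ (Fin n)) M] : Type _ :=
  ∀ p : M, TangentSpace (𝓡 n) p → TangentSpace (𝓡 n) p → ℝ

/-- A tangent vector field on the `n`-manifold `M`. -/
abbrev VecField (n : ℕ) (M : Type*) [TopologicalSpace M]
    [ChartedSpace (EuclideanSpace ℝ (Fin n)) M] : Type _ :=
  ∀ p : M, TangentSpace (𝓡 n) p

variable {n : ℕ} {M : Type*} [TopologicalSpace M] [ChartedSpace (EuclideanSpace ℝ (Fin n)) M]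

/-- The coordinate vector field `∂ᵢ` of the chart at `p`, at the point with coordinates `u`. -/
def coordField (p : M) (i : Fin n) (u : EuclideanSpace ℝ (Fin n)) :
    TangentSpace (𝓡 n) ((extChartAt (𝓡 n) p).symm u) :=
  mfderiv (𝓡 n) (𝓡 n) (extChartAt (𝓡 n) p).symm u
    (EuclideanSpace.single i (1 : ℝ) : EuclideanSpace ℝ (Fin n))

/-- The components, in the chart at `p`, of a tangent vector `v` at `q`. -/
def coords (p q : M) (v : TangentSpace (𝓡 n) q) : EuclideanSpace ℝ (Fin n) :=
  mfderiv (𝓡 n) (𝓡 n) (extChartAt (𝓡 n) p) q v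

/-- The coefficients `gᵢⱼ = g(∂ᵢ, ∂ⱼ)` in the chart at `p`. -/
def metricCoeff (g : FormField n M) (p : M) (u : EuclideanSpace ℝ (Fin n)) :
    Matrix (Fin n) (Fin n) ℝ :=
  Matrix.of fun i j => g ((extChartAt (𝓡 n) p).symm u) (coordField p i u) (coordField p j u)

/-- The components of the vector field `V` in the chart at `p`. -/
def fieldCoeff (V : VecField n M) (p : M) (u : EuclideanSpace ℝ (Fin n)) :
    EuclideanSpace ℝ (Fin n) :=
  coords p ((extChartAt (𝓡 n) p).symm u) (V ((extChartAt (𝓡 n) p).symm u))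

/-- The Ricci tensor of the metric `g`. -/
def ricciTensor (g : FormField n M) : FormField n M := fun p v w =>
  ∑ j, ∑ k, ricci (metricCoeff g p) j k (extChartAt (𝓡 n) p p)
    * coords p p v j * coords p p w k

/-- The Lie derivative `L_V g` of the metric `g` along the vector field `V`. -/
def lieDerivTensor (g : FormField n M) (V : VecField n M) : FormField n M := fun p v w =>
  ∑ i, ∑ j, lieDerivMetric (metricCoeff g p) (fieldCoeff V p) i j (extChartAt (𝓡 n) p p)
    * coords p p v i * coords p p w j

/-- The Bakry–Émery Ricci tensor `Ric_V = Ric - ½ L_V g`. -/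
def bakryEmeryRicci (g : FormField n M) (V : VecField n M) : FormField n M := fun p v w =>
  ricciTensor g p v w - (1 / 2 : ℝ) * lieDerivTensor g V p v w

/-- The Riemannian (length) distance of `g`: the infimum of `∫ √g(γ', γ')` over `C¹` paths. -/
def riemDist (g : FormField n M) (p q : M) : ENNReal :=
  letI : ∀ r : M, ENorm (TangentSpace (𝓡 n) r) :=
    fun r => ⟨fun v => ENNReal.ofReal (Real.sqrt (g r v v))⟩
  Manifold.riemannianEDist (𝓡 n) p q

/-- `(M, g)` is complete: every sequence that is Cauchy for the Riemannian distance converges. -/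
def IsCompleteMetric (g : FormField n M) : Prop :=
  ∀ s : ℕ → M, (∀ ε : ENNReal, 0 < ε → ∃ N : ℕ, ∀ k ≥ N, ∀ l ≥ N, riemDist g (s k) (s l) < ε) →
    ∃ p : M, Filter.Tendsto s Filter.atTop (𝓝 p)

end RiemGeom

/-! ## Immersed submanifolds of a Euclidean space -/

namespace Submfd

open CoordGeom RiemGeom

variable {n : ℕ} {M : Type*} [TopologicalSpace M] [ChartedSpace (EuclideanSpace ℝ (Fin n)) M]
variable {F : Type*} [NormedAddCommGroup F] [InnerProductSpace ℝ F]

/-- The differential `dx_p : T_pM → F` of `x : M → F`. -/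
def differential (x : M → F) (p : M) : EuclideanSpace ℝ (Fin n) →L[ℝ] F :=
  mfderiv (𝓡 n) 𝓘(ℝ, F) x p

/-- The induced metric `g(v, w) = ⟨dx v, dx w⟩`. -/
def inducedMetric (x : M → F) : FormField n M := fun p v w =>
  inner ℝ (differential x p v) (differential x p w)

/-- The orthogonal projection of `F` to the tangent plane `dx(T_pM)`. -/
def tangentProj (x : M → F) (p : M) (y : F) : F :=
  (LinearMap.range (differential (n := n) x p).toLinearMap).starProjection y

/-- The orthogonal projection of `F` to the normal space at `p`. -/
def normalProj (x : M → F) (p : M) (y : F) : F :=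
  y - tangentProj (n := n) x p y

/-- The tangent vector field `x^⊤` on `M`: `dx (x^⊤)` is the tangential part of the position
vector (for an immersion `x` this determines `x^⊤`). -/
def tangentPart (x : M → F) : VecField n M := fun p =>
  Function.invFun (differential (n := n) x p) (tangentProj (n := n) x p (x p))

/-- The component `hᵢⱼ = (∂ᵢ∂ⱼ x)^⊥` at `p` of the (normal-bundle-valued) second fundamental form,
in the chart at `p`. -/
def secondFF (x : M → F) (p : M) (i j : Fin n) : F :=
  normalProj (n := n) x p
    (partialD i (partialD j (x ∘ (extChartAt (𝓡 n) p).symm)) (extChartAt (𝓡 n) p p))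

/-- The inverse matrix `(gⁱʲ)` of the induced metric at `p`, in the chart at `p`. -/
def inverseMetric (x : M → F) (p : M) : Matrix (Fin n) (Fin n) ℝ :=
  (metricCoeff (inducedMetric x) p (extChartAt (𝓡 n) p p))⁻¹

/-- The mean curvature vector `H = tr_g h = ∑ gⁱʲ hᵢⱼ`. -/
def meanCurvature (x : M → F) (p : M) : F :=
  ∑ i : Fin n, ∑ j : Fin n, inverseMetric x p i j • secondFF x p i j

/-- The squared norm `S = |h|² = ∑ gⁱᵏ gʲˡ ⟨hᵢⱼ, hₖₗ⟩` of the second fundamental form. -/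
def normSqSecondFF (n : ℕ) {M : Type*} [TopologicalSpace M]
    [ChartedSpace (EuclideanSpace ℝ (Fin n)) M] (x : M → F) (p : M) : ℝ :=
  ∑ i : Fin n, ∑ j : Fin n, ∑ k : Fin n, ∑ l : Fin n,
    inverseMetric x p i k * inverseMetric x p j l * inner ℝ (secondFF x p i j) (secondFF x p k l)

/-- `x` is a smooth immersion. -/
structure IsSmoothImmersion (n : ℕ) {M : Type*} [TopologicalSpace M]
    [ChartedSpace (EuclideanSpace ℝ (Fin n)) M] (x : M → F) : Prop where
  smooth : ContMDiff (𝓡 n) 𝓘(ℝ, F) ∞ x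
  injective_differential : ∀ p : M, Function.Injective (differential (n := n) x p)

/-- The immersion `x` is a self-expander: `H = x^⊥`. -/
def IsSelfExpander (n : ℕ) {M : Type*} [TopologicalSpace M]
    [ChartedSpace (EuclideanSpace ℝ (Fin n)) M] (x : M → F) : Prop :=
  ∀ p : M, meanCurvature (n := n) x p = normalProj (n := n) x p (x p)

end Submfd

end

/-!
Put `φ = x ∘ (extChartAt p).symm` and let `h` be its second fundamental form. In the chart at `p`:

* Gauss's equation gives `Ric(v, v) = ⟨H, h(v, v)⟩ - ∑ₐ |h(v, eₐ)|²` for an orthonormal basis `eₐ`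
  of the tangent space (`CoordGeom.IsImmersedPatch.ricci_eq`);
* differentiating `⟨φ - φ^⊤, ∂ⱼφ⟩ = 0` gives `½ (L_{φ^⊤} g)(v, v) = |v|² + ⟨φ^⊥, h(v, v)⟩`
  (`CoordGeom.IsImmersedPatch.lieDerivMetric_eq`).

Since `H = φ^⊥`, subtracting leaves `-|v|² - ∑ₐ |h(v, eₐ)|²`, and `∑ₐ |h(v, eₐ)|² ≤ |h|² |v|²` by
the Cauchy–Schwarz inequality (`CoordGeom.sum_inv_mul_inner_le`).
-/

open scoped Manifold ContDiff Topology

namespace CoordGeom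

open Matrix

variable {n : ℕ} {F : Type*} [NormedAddCommGroup F] [InnerProductSpace ℝ F]

/-! ### Coordinate derivatives -/

section Calculus

variable {U : Set (EuclideanSpace ℝ (Fin n))} {u : EuclideanSpace ℝ (Fin n)}

theorem partialD_congr {f g : EuclideanSpace ℝ (Fin n) → F} (hU : IsOpen U)
    (h : Set.EqOn f g U) (hu : u ∈ U) (i : Fin n) : partialD i f u = partialD i g u := by
  have : f =ᶠ[𝓝 u] g := Filter.eventuallyEq_of_mem (hU.mem_nhds hu) h
  rw [partialD, partialD, this.fderiv_eq]

theorem contDiffOn_partialD {f : EuclideanSpace ℝ (Fin n) → F} (hU : IsOpen U)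
    (hf : ContDiffOn ℝ ∞ f U) (i : Fin n) : ContDiffOn ℝ ∞ (partialD i f) U :=
  (hf.fderiv_of_isOpen hU (by simp)).clm_apply contDiffOn_const

theorem partialD_inner {f g : EuclideanSpace ℝ (Fin n) → F} (hf : DifferentiableAt ℝ f u)
    (hg : DifferentiableAt ℝ g u) (i : Fin n) :
    partialD i (fun w => inner ℝ (f w) (g w)) u
      = inner ℝ (f u) (partialD i g u) + inner ℝ (partialD i f u) (g u) :=
  fderiv_inner_apply ℝ hf hg _

theorem partialD_add {f g : EuclideanSpace ℝ (Fin n) → F} (hf : DifferentiableAt ℝ f u)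
    (hg : DifferentiableAt ℝ g u) (i : Fin n) :
    partialD i (fun w => f w + g w) u = partialD i f u + partialD i g u := by
  simp [partialD, fderiv_fun_add hf hg]

theorem partialD_sub {f g : EuclideanSpace ℝ (Fin n) → F} (hf : DifferentiableAt ℝ f u)
    (hg : DifferentiableAt ℝ g u) (i : Fin n) :
    partialD i (fun w => f w - g w) u = partialD i f u - partialD i g u := by
  simp [partialD, fderiv_fun_sub hf hg]

theorem partialD_sum_smul {ι : Type*} {s : Finset ι} {c : ι → EuclideanSpace ℝ (Fin n) → ℝ}
    {f : ι → EuclideanSpace ℝ (Fin n) → F} (hc : ∀ a ∈ s, DifferentiableAt ℝ (c a) u)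
    (hf : ∀ a ∈ s, DifferentiableAt ℝ (f a) u) (i : Fin n) :
    partialD i (fun w => ∑ a ∈ s, c a w • f a w) u
      = ∑ a ∈ s, (c a u • partialD i (f a) u + partialD i (c a) u • f a u) := by
  have h : ∀ a ∈ s, HasFDerivAt (fun w => c a w • f a w)
      (c a u • fderiv ℝ (f a) u + (fderiv ℝ (c a) u).smulRight (f a u)) u :=
    fun a ha => (hc a ha).hasFDerivAt.smul (hf a ha).hasFDerivAt
  simp [partialD, (HasFDerivAt.fun_sum h).fderiv]

theorem partialD_comm {f : EuclideanSpace ℝ (Fin n) → F} (hU : IsOpen U)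
    (hf : ContDiffOn ℝ ∞ f U) (hu : u ∈ U) (i j : Fin n) :
    partialD i (partialD j f) u = partialD j (partialD i f) u := by
  have hfu : ContDiffAt ℝ ∞ f u := hf.contDiffAt (hU.mem_nhds hu)
  have hd : DifferentiableAt ℝ (fderiv ℝ f) u :=
    (hfu.fderiv_right (m := 1) (by norm_cast)).differentiableAt (by simp)
  have h2 : ∀ a b : Fin n, partialD a (partialD b f) u
      = fderiv ℝ (fderiv ℝ f) u (EuclideanSpace.single a 1) (EuclideanSpace.single b 1) := by
    intro a b
    change fderiv ℝ (fun w => fderiv ℝ f w (EuclideanSpace.single b 1)) u _ = _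
    rw [fderiv_clm_apply hd (differentiableAt_const _)]
    simp
  rw [h2, h2]
  have hsmooth : minSmoothness ℝ 2 ≤ ∞ := by
    simp only [minSmoothness_of_isRCLikeNormedField]
    norm_cast
  exact (hfu.isSymmSndFDerivAt hsmooth).eq _ _

theorem fderiv_eq_sum_partialD (f : EuclideanSpace ℝ (Fin n) → F)
    (y : EuclideanSpace ℝ (Fin n)) : fderiv ℝ f u y = ∑ i, y i • partialD i f u := by
  have hy : y = ∑ i, y i • EuclideanSpace.single i (1 : ℝ) := by
    ext j
    simp [Pi.single_apply]
  conv_lhs => rw [hy]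
  simp [partialD]

theorem contDiffOn_det {m : Type*} [Fintype m] [DecidableEq m]
    {A : EuclideanSpace ℝ (Fin n) → Matrix m m ℝ}
    (hA : ∀ i j, ContDiffOn ℝ ∞ (fun w => A w i j) U) : ContDiffOn ℝ ∞ (fun w => (A w).det) U := by
  simp only [Matrix.det_apply]
  exact ContDiffOn.sum fun σ _ => (contDiffOn_prod fun i _ => hA _ _).const_smul _

theorem contDiffOn_inv_apply {m : Type*} [Fintype m] [DecidableEq m]
    {A : EuclideanSpace ℝ (Fin n) → Matrix m m ℝ}
    (hA : ∀ i j, ContDiffOn ℝ ∞ (fun w => A w i j) U) (hdet : ∀ w ∈ U, (A w).det ≠ 0) (i j : m) :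
    ContDiffOn ℝ ∞ (fun w => (A w)⁻¹ i j) U := by
  simp only [Matrix.inv_def, Matrix.smul_apply, Ring.inverse_eq_inv', smul_eq_mul,
    Matrix.adjugate_apply]
  refine ((contDiffOn_det hA).inv hdet).mul (contDiffOn_det fun a b => ?_)
  simp only [Matrix.updateRow_apply]
  split_ifs
  · exact contDiffOn_const
  · exact hA a b

end Calculus

/-! ### Gauss's formula and equation for an immersion in coordinates -/

/-- `φ` is a smooth immersion of the open set `U` of coordinates and `G` agrees on `U` with the
coefficients of the metric that `φ` induces. Off `U`, nothing is asked of `φ` or `G`. -/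
structure IsImmersedPatch (φ : EuclideanSpace ℝ (Fin n) → F)
    (G : EuclideanSpace ℝ (Fin n) → Matrix (Fin n) (Fin n) ℝ)
    (U : Set (EuclideanSpace ℝ (Fin n))) : Prop where
  isOpen : IsOpen U
  contDiffOn : ContDiffOn ℝ ∞ φ U
  linearIndependent : ∀ u ∈ U, LinearIndependent ℝ fun i => partialD i φ u
  metric : ∀ u ∈ U, ∀ i j, G u i j = inner ℝ (partialD i φ u) (partialD j φ u)

/-- The normal part `∂ᵢ∂ⱼφ - ∑ₖ Γᵏᵢⱼ ∂ₖφ` of the second derivative of `φ`. -/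
noncomputable def hessNormal (φ : EuclideanSpace ℝ (Fin n) → F)
    (G : EuclideanSpace ℝ (Fin n) → Matrix (Fin n) (Fin n) ℝ) (i j : Fin n)
    (u : EuclideanSpace ℝ (Fin n)) : F :=
  partialD i (partialD j φ) u - ∑ k, christoffel G k i j u • partialD k φ u

namespace IsImmersedPatch

variable {φ : EuclideanSpace ℝ (Fin n) → F}
  {G : EuclideanSpace ℝ (Fin n) → Matrix (Fin n) (Fin n) ℝ}
  {U : Set (EuclideanSpace ℝ (Fin n))} {u : EuclideanSpace ℝ (Fin n)}

variable (hφ : IsImmersedPatch φ G U)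
include hφ

theorem contDiffOn_frame (i : Fin n) : ContDiffOn ℝ ∞ (partialD i φ) U :=
  contDiffOn_partialD hφ.isOpen hφ.contDiffOn i

theorem differentiableAt {H : Type*} [NormedAddCommGroup H] [NormedSpace ℝ H]
    {f : EuclideanSpace ℝ (Fin n) → H} (hf : ContDiffOn ℝ ∞ f U) (hu : u ∈ U) :
    DifferentiableAt ℝ f u :=
  (hf.contDiffAt (hφ.isOpen.mem_nhds hu)).differentiableAt (by simp)

theorem posDef (hu : u ∈ U) : (G u).PosDef := by
  have : G u = Matrix.gram ℝ fun i => partialD i φ u := by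
    ext i j
    rw [hφ.metric u hu, Matrix.gram_apply]
  rw [this]
  exact Matrix.posDef_gram_of_linearIndependent (hφ.linearIndependent u hu)

theorem det_ne_zero (hu : u ∈ U) : (G u).det ≠ 0 := (hφ.posDef hu).det_pos.ne'

theorem metric_symm (hu : u ∈ U) (i j : Fin n) : G u i j = G u j i := by
  rw [hφ.metric u hu, hφ.metric u hu, real_inner_comm]

theorem sum_metric_mul_inv (hu : u ∈ U) (c : Fin n → ℝ) (m : Fin n) :
    ∑ k, (∑ l, (G u)⁻¹ k l * c l) * G u k m = c m := by
  have h : (G u) *ᵥ ((G u)⁻¹ *ᵥ c) = c := by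
    rw [Matrix.mulVec_mulVec, Matrix.mul_nonsing_inv _ (hφ.det_ne_zero hu).isUnit,
      Matrix.one_mulVec]
  have h' := congrFun h m
  simp only [Matrix.mulVec, dotProduct] at h'
  rw [← h']
  exact Finset.sum_congr rfl fun k _ => by rw [hφ.metric_symm hu k m, mul_comm]

theorem sum_inv_mul_metric (hu : u ∈ U) (c : Fin n → ℝ) (k : Fin n) :
    ∑ m, (G u)⁻¹ k m * ∑ l, G u m l * c l = c k := by
  have h : (G u)⁻¹ *ᵥ ((G u) *ᵥ c) = c := by
    rw [Matrix.mulVec_mulVec, Matrix.nonsing_inv_mul _ (hφ.det_ne_zero hu).isUnit,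
      Matrix.one_mulVec]
  exact congrFun h k

theorem contDiffOn_metric (i j : Fin n) : ContDiffOn ℝ ∞ (fun w => G w i j) U :=
  ((hφ.contDiffOn_frame i).inner ℝ (hφ.contDiffOn_frame j)).congr fun w hw => hφ.metric w hw i j

theorem contDiffOn_inv (i j : Fin n) : ContDiffOn ℝ ∞ (fun w => (G w)⁻¹ i j) U :=
  contDiffOn_inv_apply hφ.contDiffOn_metric (fun _ hw => hφ.det_ne_zero hw) i j

theorem contDiffOn_christoffel (k i j : Fin n) : ContDiffOn ℝ ∞ (christoffel G k i j) U := by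
  have hp := fun a b c => contDiffOn_partialD hφ.isOpen (hφ.contDiffOn_metric b c) a
  exact contDiffOn_const.mul <| ContDiffOn.sum fun l _ =>
    (hφ.contDiffOn_inv k l).mul (((hp i j l).add (hp j i l)).sub (hp l i j))

theorem contDiffOn_hess (i j : Fin n) : ContDiffOn ℝ ∞ (partialD i (partialD j φ)) U :=
  contDiffOn_partialD hφ.isOpen (hφ.contDiffOn_frame j) i

theorem contDiffOn_hessNormal (i j : Fin n) : ContDiffOn ℝ ∞ (hessNormal φ G i j) U :=
  (hφ.contDiffOn_hess i j).sub <| ContDiffOn.sum fun k _ =>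
    (hφ.contDiffOn_christoffel k i j).smul (hφ.contDiffOn_frame k)

theorem partialD_metric (hu : u ∈ U) (k i j : Fin n) :
    partialD k (fun w => G w i j) u
      = inner ℝ (partialD i φ u) (partialD k (partialD j φ) u)
        + inner ℝ (partialD k (partialD i φ) u) (partialD j φ u) := by
  rw [partialD_congr hφ.isOpen (fun w hw => hφ.metric w hw i j) hu,
    partialD_inner (hφ.differentiableAt (hφ.contDiffOn_frame i) hu)
      (hφ.differentiableAt (hφ.contDiffOn_frame j) hu)]

/-- The Christoffel symbols are the components of the tangential part of `∂ᵢ∂ⱼφ`. -/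
theorem christoffel_eq (hu : u ∈ U) (k i j : Fin n) :
    christoffel G k i j u
      = ∑ l, (G u)⁻¹ k l * inner ℝ (partialD i (partialD j φ) u) (partialD l φ u) := by
  rw [christoffel, Finset.mul_sum]
  refine Finset.sum_congr rfl fun l _ => ?_
  rw [hφ.partialD_metric hu, hφ.partialD_metric hu, hφ.partialD_metric hu,
    partialD_comm hφ.isOpen hφ.contDiffOn hu j i, partialD_comm hφ.isOpen hφ.contDiffOn hu l i,
    partialD_comm hφ.isOpen hφ.contDiffOn hu l j,
    real_inner_comm (partialD j φ u) (partialD i (partialD l φ) u)]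
  ring

theorem christoffel_symm (hu : u ∈ U) (k i j : Fin n) :
    christoffel G k i j u = christoffel G k j i u := by
  rw [hφ.christoffel_eq hu, hφ.christoffel_eq hu, partialD_comm hφ.isOpen hφ.contDiffOn hu i j]

theorem hessNormal_symm (hu : u ∈ U) (i j : Fin n) :
    hessNormal φ G i j u = hessNormal φ G j i u := by
  simp only [hessNormal, partialD_comm hφ.isOpen hφ.contDiffOn hu i j,
    hφ.christoffel_symm hu _ i j]

theorem inner_hessNormal (hu : u ∈ U) (i j m : Fin n) :
    inner ℝ (hessNormal φ G i j u) (partialD m φ u) = 0 := by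
  rw [hessNormal, inner_sub_left, sum_inner, sub_eq_zero]
  simp only [real_inner_smul_left, ← hφ.metric u hu, hφ.christoffel_eq hu]
  rw [hφ.sum_metric_mul_inv hu]

/-- Weingarten's equation: differentiating `⟨hⱼₖ, ∂ₘφ⟩ = 0`. -/
theorem inner_partialD_hessNormal (hu : u ∈ U) (i j k m : Fin n) :
    inner ℝ (partialD i (hessNormal φ G j k) u) (partialD m φ u)
      = -inner ℝ (hessNormal φ G j k u) (hessNormal φ G i m u) := by
  have h0 : partialD i (fun w => inner ℝ (hessNormal φ G j k w) (partialD m φ w)) u = 0 := by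
    rw [partialD_congr hφ.isOpen (g := fun _ => (0 : ℝ))
      (fun w hw => hφ.inner_hessNormal hw j k m) hu]
    simp [partialD]
  rw [partialD_inner (hφ.differentiableAt (hφ.contDiffOn_hessNormal j k) hu)
    (hφ.differentiableAt (hφ.contDiffOn_frame m) hu)] at h0
  have h1 : inner ℝ (hessNormal φ G j k u) (hessNormal φ G i m u)
      = inner ℝ (hessNormal φ G j k u) (partialD i (partialD m φ) u) := by
    conv_lhs => rw [hessNormal.eq_def φ G i m]
    simp [inner_sub_right, inner_sum, real_inner_smul_right, hφ.inner_hessNormal hu]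
  linarith

/-- The tangential part of the third derivatives of `φ`, from differentiating Gauss's formula
`∂ⱼ∂ₖφ = ∑ₗ Γˡⱼₖ ∂ₗφ + hⱼₖ`. -/
theorem inner_partialD_hess (hu : u ∈ U) (i j k m : Fin n) :
    inner ℝ (partialD i (partialD j (partialD k φ)) u) (partialD m φ u)
      = (∑ l, G u m l * (partialD i (christoffel G l j k) u
          + ∑ a, christoffel G l i a u * christoffel G a j k u))
        - inner ℝ (hessNormal φ G j k u) (hessNormal φ G i m u) := by
  have hdec : partialD i (partialD j (partialD k φ)) u
      = ∑ l, (christoffel G l j k u • partialD i (partialD l φ) u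
          + partialD i (christoffel G l j k) u • partialD l φ u)
        + partialD i (hessNormal φ G j k) u := by
    have h1 : partialD j (partialD k φ)
        = fun w => (∑ l, christoffel G l j k w • partialD l φ w) + hessNormal φ G j k w := by
      funext w
      simp [hessNormal]
    rw [h1, partialD_add, partialD_sum_smul]
    · exact fun l _ => hφ.differentiableAt (hφ.contDiffOn_christoffel l j k) hu
    · exact fun l _ => hφ.differentiableAt (hφ.contDiffOn_frame l) hu
    · exact hφ.differentiableAt (ContDiffOn.sum fun l _ =>
        (hφ.contDiffOn_christoffel l j k).smul (hφ.contDiffOn_frame l)) hu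
    · exact hφ.differentiableAt (hφ.contDiffOn_hessNormal j k) hu
  have hin : ∀ a, inner ℝ (partialD i (partialD a φ) u) (partialD m φ u)
      = ∑ l, christoffel G l i a u * G u m l := by
    intro a
    have h2 : partialD i (partialD a φ) u
        = (∑ l, christoffel G l i a u • partialD l φ u) + hessNormal φ G i a u := by
      simp [hessNormal]
    rw [h2, inner_add_left, hφ.inner_hessNormal hu, add_zero, sum_inner]
    refine Finset.sum_congr rfl fun l _ => ?_
    rw [real_inner_smul_left, hφ.metric_symm hu m l, hφ.metric u hu]
  rw [hdec, inner_add_left, hφ.inner_partialD_hessNormal hu, sum_inner, ← sub_eq_add_neg]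
  congr 1
  simp only [inner_add_left, real_inner_smul_left, hin, mul_add, Finset.sum_add_distrib,
    Finset.mul_sum]
  rw [add_comm]
  congr 1
  · refine Finset.sum_congr rfl fun l _ => ?_
    rw [hφ.metric_symm hu m l, hφ.metric u hu, mul_comm]
  · rw [Finset.sum_comm]
    exact Finset.sum_congr rfl fun l _ => Finset.sum_congr rfl fun a _ => by ring

/-- Gauss's equation `⟨R(∂ᵢ, ∂ⱼ)∂ₖ, ∂ₘ⟩ = ⟨hⱼₖ, hᵢₘ⟩ - ⟨hᵢₖ, hⱼₘ⟩`. -/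
theorem sum_metric_mul_riemann (hu : u ∈ U) (i j k m : Fin n) :
    ∑ l, G u m l * riemann G l k i j u
      = inner ℝ (hessNormal φ G j k u) (hessNormal φ G i m u)
        - inner ℝ (hessNormal φ G i k u) (hessNormal φ G j m u) := by
  have h1 := hφ.inner_partialD_hess hu i j k m
  have h2 := hφ.inner_partialD_hess hu j i k m
  rw [partialD_comm hφ.isOpen (hφ.contDiffOn_frame k) hu i j] at h1
  have h3 : ∑ l, G u m l * riemann G l k i j u
      = (∑ l, G u m l * (partialD i (christoffel G l j k) u
          + ∑ a, christoffel G l i a u * christoffel G a j k u))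
        - ∑ l, G u m l * (partialD j (christoffel G l i k) u
          + ∑ a, christoffel G l j a u * christoffel G a i k u) := by
    rw [← Finset.sum_sub_distrib]
    refine Finset.sum_congr rfl fun l _ => ?_
    rw [riemann, Finset.sum_sub_distrib]
    ring
  linarith

/-- The Ricci tensor of an immersed submanifold of a Euclidean space. -/
theorem ricci_eq (hu : u ∈ U) (j k : Fin n) :
    ricci G j k u
      = inner ℝ (∑ i, ∑ m, (G u)⁻¹ i m • hessNormal φ G i m u) (hessNormal φ G j k u)
        - ∑ i, ∑ m, (G u)⁻¹ i m *
            inner ℝ (hessNormal φ G i k u) (hessNormal φ G m j u) := by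
  simp only [ricci, sum_inner, real_inner_smul_left, ← Finset.sum_sub_distrib]
  refine Finset.sum_congr rfl fun i _ => ?_
  rw [← hφ.sum_inv_mul_metric hu (fun l => riemann G l k i j u) i]
  refine Finset.sum_congr rfl fun m _ => ?_
  rw [hφ.sum_metric_mul_riemann hu, real_inner_comm, hφ.hessNormal_symm hu j m]
  ring

/-- If `∑ₖ Vᵏ ∂ₖφ` is the tangential part of `φ`, then
`L_V g = 2 (g + ⟨φ - ∑ₖ Vᵏ ∂ₖφ, h⟩)`. -/
theorem lieDerivMetric_eq {V : EuclideanSpace ℝ (Fin n) → EuclideanSpace ℝ (Fin n)}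
    (hV : ∀ w ∈ U, ∀ j, inner ℝ (φ w - ∑ k, V w k • partialD k φ w) (partialD j φ w) = 0)
    (hu : u ∈ U) (i j : Fin n) :
    lieDerivMetric G V i j u
      = 2 * (G u i j
        + inner ℝ (φ u - ∑ k, V u k • partialD k φ u) (hessNormal φ G i j u)) := by
  -- `hV` says nothing about the regularity of `V`; it follows from `Vᵏ = ∑ₘ gᵏᵐ ⟨φ, ∂ₘφ⟩`.
  have hVeq : ∀ k, Set.EqOn (fun w => V w k)
      (fun w => ∑ m, (G w)⁻¹ k m * inner ℝ (φ w) (partialD m φ w)) U := by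
    intro k w hw
    have h1 : ∀ m, inner ℝ (φ w) (partialD m φ w) = ∑ l, G w m l * V w l := by
      intro m
      have := hV w hw m
      rw [inner_sub_left, sum_inner, sub_eq_zero] at this
      rw [this]
      refine Finset.sum_congr rfl fun l _ => ?_
      rw [real_inner_smul_left, hφ.metric_symm hw, hφ.metric w hw, mul_comm]
    simp only [h1]
    exact (hφ.sum_inv_mul_metric hw (fun l => V w l) k).symm
  have hVd : ∀ k, ContDiffOn ℝ ∞ (fun w => V w k) U := fun k =>
    (ContDiffOn.sum fun m _ => (hφ.contDiffOn_inv k m).mul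
      (hφ.contDiffOn.inner ℝ (hφ.contDiffOn_frame m))).congr (hVeq k)
  have hTd : ContDiffOn ℝ ∞ (fun w => ∑ k, V w k • partialD k φ w) U :=
    ContDiffOn.sum fun k _ => (hVd k).smul (hφ.contDiffOn_frame k)
  -- The derivative of `⟨φ - ∑ₖ Vᵏ ∂ₖφ, ∂_b φ⟩ = 0` along `∂_a`.
  have key : ∀ a b, G u a b
        + inner ℝ (φ u - ∑ k, V u k • partialD k φ u) (hessNormal φ G a b u)
      = ∑ k, (V u k * inner ℝ (partialD a (partialD k φ) u) (partialD b φ u)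
          + partialD a (fun w => V w k) u * G u k b) := by
    intro a b
    have h0 : partialD a (fun w => inner ℝ (φ w - ∑ k, V w k • partialD k φ w)
        (partialD b φ w)) u = 0 := by
      rw [partialD_congr hφ.isOpen (g := fun _ => (0 : ℝ)) (fun w hw => hV w hw b) hu]
      simp [partialD]
    rw [partialD_inner (hφ.differentiableAt (hφ.contDiffOn.sub hTd) hu)
      (hφ.differentiableAt (hφ.contDiffOn_frame b) hu),
      partialD_sub (hφ.differentiableAt hφ.contDiffOn hu) (hφ.differentiableAt hTd hu),
      partialD_sum_smul (fun k _ => hφ.differentiableAt (hVd k) hu)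
        (fun k _ => hφ.differentiableAt (hφ.contDiffOn_frame k) hu)] at h0
    have h1 : inner ℝ (φ u - ∑ k, V u k • partialD k φ u) (hessNormal φ G a b u)
        = inner ℝ (φ u - ∑ k, V u k • partialD k φ u) (partialD a (partialD b φ) u) := by
      conv_lhs => rw [hessNormal]
      rw [inner_sub_right, inner_sum]
      simp [real_inner_smul_right, hV u hu]
    rw [h1]
    simp only [inner_sub_left (partialD a φ u), sum_inner, inner_add_left, real_inner_smul_left,
      ← hφ.metric u hu] at h0
    linarith
  have hsymm : inner ℝ (φ u - ∑ k, V u k • partialD k φ u) (hessNormal φ G j i u)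
      = inner ℝ (φ u - ∑ k, V u k • partialD k φ u) (hessNormal φ G i j u) := by
    rw [hφ.hessNormal_symm hu]
  have k1 := key i j
  have k2 := key j i
  rw [hsymm, hφ.metric_symm hu] at k2
  rw [two_mul]
  nth_rewrite 1 [k1]
  rw [k2, ← Finset.sum_add_distrib, lieDerivMetric]
  refine Finset.sum_congr rfl fun k _ => ?_
  rw [hφ.partialD_metric hu, partialD_comm hφ.isOpen hφ.contDiffOn hu k i,
    partialD_comm hφ.isOpen hφ.contDiffOn hu k j, hφ.metric_symm hu i k,
    real_inner_comm (partialD i φ u)]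
  ring

end IsImmersedPatch

end CoordGeom

/-! ### The Cauchy–Schwarz inequality for a vector-valued bilinear form -/

namespace CoordGeom

open Matrix

open scoped MatrixOrder Matrix.Norms.L2Operator in
theorem exists_transpose_mul_self_of_posSemidef {m : Type*} [Fintype m] [DecidableEq m]
    {A : Matrix m m ℝ} (hA : A.PosSemidef) : ∃ B : Matrix m m ℝ, A = Bᵀ * B := by
  obtain ⟨B, hB⟩ := CStarAlgebra.nonneg_iff_eq_star_mul_self.mp hA.nonneg
  exact ⟨B, by rw [hB, Matrix.star_eq_conjTranspose, Matrix.conjTranspose_eq_transpose_of_trivial]⟩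

variable {m : Type*} [Fintype m] {F : Type*} [NormedAddCommGroup F] [InnerProductSpace ℝ F]

theorem sum_comm_three (f : m → m → m → ℝ) :
    ∑ i, ∑ j, ∑ k, f i j k = ∑ k, ∑ i, ∑ j, f i j k :=
  (Finset.sum_congr rfl fun _ _ => Finset.sum_comm).trans Finset.sum_comm

theorem sum_transpose_mul_self_mul_inner (B : Matrix m m ℝ) (w z : m → F) :
    ∑ i, ∑ k, (Bᵀ * B) i k * inner ℝ (w i) (z k)
      = ∑ a, inner ℝ (∑ i, B a i • w i) (∑ k, B a k • z k) := by
  simp only [sum_inner, inner_sum, real_inner_smul_left, real_inner_smul_right, Matrix.mul_apply,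
    Matrix.transpose_apply, Finset.sum_mul]
  rw [sum_comm_three]
  refine Finset.sum_congr rfl fun a _ => ?_
  rw [Finset.sum_comm]
  exact Finset.sum_congr rfl fun i _ => Finset.sum_congr rfl fun k _ => by ring

theorem norm_sum_smul_sq_le (y : m → ℝ) (e : m → F) :
    ‖∑ b, y b • e b‖ ^ 2 ≤ (∑ b, ‖e b‖ ^ 2) * ∑ b, y b ^ 2 := by
  have h1 : ‖∑ b, y b • e b‖ ≤ ∑ b, ‖e b‖ * |y b| :=
    (norm_sum_le _ _).trans_eq (Finset.sum_congr rfl fun b _ => by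
      rw [norm_smul, Real.norm_eq_abs, mul_comm])
  calc ‖∑ b, y b • e b‖ ^ 2 ≤ (∑ b, ‖e b‖ * |y b|) ^ 2 := by gcongr
    _ ≤ (∑ b, ‖e b‖ ^ 2) * ∑ b, |y b| ^ 2 := Finset.sum_mul_sq_le_sq_mul_sq _ _ _
    _ = _ := by simp only [sq_abs]

/-- The Cauchy–Schwarz inequality `∑ₐ |h(v, eₐ)|² ≤ |h|² |v|²` for a vector-valued bilinear form
`h` and a `G`-orthonormal basis `(eₐ)`. -/
theorem sum_inv_mul_inner_le [DecidableEq m] {G : Matrix m m ℝ} (hG : G.PosDef) (h : m → m → F)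
    (v : m → ℝ) :
    ∑ i, ∑ k, G⁻¹ i k * inner ℝ (∑ j, v j • h i j) (∑ j, v j • h k j)
      ≤ (∑ i, ∑ j, ∑ k, ∑ l, G⁻¹ i k * G⁻¹ j l * inner ℝ (h i j) (h k l))
        * ∑ i, ∑ j, G i j * v i * v j := by
  obtain ⟨B, hB⟩ := exists_transpose_mul_self_of_posSemidef hG.inv.posSemidef
  -- The rows of `B` are a `G`-orthonormal basis, and `y` lists the components of `v` in it.
  set y : m → ℝ := B *ᵥ (G *ᵥ v) with hy
  have hv : Bᵀ *ᵥ y = v := by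
    rw [hy, Matrix.mulVec_mulVec, ← hB, Matrix.mulVec_mulVec,
      Matrix.nonsing_inv_mul _ hG.det_pos.ne'.isUnit, Matrix.one_mulVec]
  have hnorm : ∑ i, ∑ j, G i j * v i * v j = ∑ b, y b ^ 2 := by
    have h1 : v ⬝ᵥ (G *ᵥ v) = y ⬝ᵥ y := by
      have h2 : (Bᵀ *ᵥ y) ⬝ᵥ (G *ᵥ v) = y ⬝ᵥ (B *ᵥ (G *ᵥ v)) := by
        rw [Matrix.mulVec_transpose, ← Matrix.dotProduct_mulVec]
      rwa [hv, ← hy] at h2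
    simp only [dotProduct, Matrix.mulVec, Finset.mul_sum] at h1
    simp only [sq]
    rw [← h1]
    exact Finset.sum_congr rfl fun i _ => Finset.sum_congr rfl fun j _ => by ring
  have hS : ∑ i, ∑ j, ∑ k, ∑ l, G⁻¹ i k * G⁻¹ j l * inner ℝ (h i j) (h k l)
      = ∑ a, ∑ b, ‖∑ j, B b j • ∑ i, B a i • h i j‖ ^ 2 := by
    calc _ = ∑ j, ∑ l, G⁻¹ j l * ∑ i, ∑ k, G⁻¹ i k * inner ℝ (h i j) (h k l) := by
          rw [Finset.sum_comm]
          refine Finset.sum_congr rfl fun j _ => ?_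
          simp only [Finset.mul_sum]
          rw [sum_comm_three]
          exact Finset.sum_congr rfl fun l _ => Finset.sum_congr rfl fun i _ =>
            Finset.sum_congr rfl fun k _ => by ring
      _ = _ := by
          simp only [hB, sum_transpose_mul_self_mul_inner, Finset.mul_sum]
          rw [sum_comm_three]
          simp only [sum_transpose_mul_self_mul_inner, real_inner_self_eq_norm_sq]
  have hw : ∀ a, ∑ i, B a i • ∑ j, v j • h i j
      = ∑ b, y b • ∑ j, B b j • ∑ i, B a i • h i j := by
    intro a
    have h1 : ∀ j, v j = ∑ b, y b * B b j := fun j => by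
      conv_lhs => rw [← hv]
      simp [Matrix.mulVec, dotProduct, mul_comm]
    calc ∑ i, B a i • ∑ j, v j • h i j = ∑ j, v j • ∑ i, B a i • h i j := by
          simp only [Finset.smul_sum]
          rw [Finset.sum_comm]
          exact Finset.sum_congr rfl fun j _ => Finset.sum_congr rfl fun i _ => smul_comm _ _ _
      _ = ∑ j, ∑ b, y b • B b j • ∑ i, B a i • h i j :=
          Finset.sum_congr rfl fun j _ => by rw [h1 j, Finset.sum_smul]; simp only [mul_smul]
      _ = _ := by rw [Finset.sum_comm]; simp only [Finset.smul_sum]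
  rw [hS, hnorm, hB, sum_transpose_mul_self_mul_inner, Finset.sum_mul]
  refine Finset.sum_le_sum fun a _ => ?_
  rw [real_inner_self_eq_norm_sq, hw]
  exact norm_sum_smul_sq_le _ _

end CoordGeom

/-! ### The pointwise bound in coordinates -/

namespace CoordGeom.IsImmersedPatch

variable {n : ℕ} {F : Type*} [NormedAddCommGroup F] [InnerProductSpace ℝ F]
  {φ : EuclideanSpace ℝ (Fin n) → F}
  {G : EuclideanSpace ℝ (Fin n) → Matrix (Fin n) (Fin n) ℝ}
  {U : Set (EuclideanSpace ℝ (Fin n))} {u : EuclideanSpace ℝ (Fin n)}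

/-- If the mean curvature vector equals the normal part of the position vector at `u`, the terms
`⟨H, h(c, c)⟩` of `Ric` and `⟨φ^⊥, h(c, c)⟩` of `½ L_V g` cancel. -/
theorem neg_mul_le_ricci_sub_lieDerivMetric (hφ : IsImmersedPatch φ G U)
    {V : EuclideanSpace ℝ (Fin n) → EuclideanSpace ℝ (Fin n)}
    (hV : ∀ w ∈ U, ∀ j, inner ℝ (φ w - ∑ k, V w k • partialD k φ w) (partialD j φ w) = 0)
    (hu : u ∈ U)
    (hH : ∑ i, ∑ j, (G u)⁻¹ i j • hessNormal φ G i j u = φ u - ∑ k, V u k • partialD k φ u)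
    (c : Fin n → ℝ) :
    -((∑ i, ∑ j, ∑ k, ∑ l, (G u)⁻¹ i k * (G u)⁻¹ j l *
        inner ℝ (hessNormal φ G i j u) (hessNormal φ G k l u)) + 1)
        * ∑ i, ∑ j, G u i j * c i * c j
      ≤ (∑ j, ∑ k, ricci G j k u * c j * c k)
        - (1 / 2 : ℝ) * ∑ i, ∑ j, lieDerivMetric G V i j u * c i * c j := by
  have hcs := sum_inv_mul_inner_le (hφ.posDef hu) (fun i j => hessNormal φ G i j u) c
  have hquad : ∑ i, ∑ m, (G u)⁻¹ i m *
        inner ℝ (∑ j, c j • hessNormal φ G i j u) (∑ j, c j • hessNormal φ G m j u)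
      = ∑ j, ∑ k, (∑ i, ∑ m, (G u)⁻¹ i m *
          inner ℝ (hessNormal φ G i k u) (hessNormal φ G m j u)) * c j * c k := by
    simp only [sum_inner, inner_sum, real_inner_smul_left, real_inner_smul_right, Finset.mul_sum,
      Finset.sum_mul]
    rw [Finset.sum_congr rfl fun i _ => sum_comm_three _, Finset.sum_comm]
    conv_rhs => rw [Finset.sum_comm]
    refine Finset.sum_congr rfl fun j _ => ?_
    rw [Finset.sum_congr rfl fun i _ => Finset.sum_comm, Finset.sum_comm]
    exact Finset.sum_congr rfl fun k _ => Finset.sum_congr rfl fun i _ =>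
      Finset.sum_congr rfl fun m _ => by ring
  have hsum : (∑ j, ∑ k, ricci G j k u * c j * c k)
        - (1 / 2 : ℝ) * ∑ i, ∑ j, lieDerivMetric G V i j u * c i * c j
      = -(∑ i, ∑ j, G u i j * c i * c j)
        - ∑ j, ∑ k, (∑ i, ∑ m, (G u)⁻¹ i m *
          inner ℝ (hessNormal φ G i k u) (hessNormal φ G m j u)) * c j * c k := by
    simp only [Finset.mul_sum (a := (1 / 2 : ℝ)), ← Finset.sum_sub_distrib,
      ← Finset.sum_neg_distrib]
    refine Finset.sum_congr rfl fun j _ => Finset.sum_congr rfl fun k _ => ?_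
    rw [hφ.ricci_eq hu, hφ.lieDerivMetric_eq hV hu, hH]
    ring
  rw [hsum, ← hquad]
  linarith

end CoordGeom.IsImmersedPatch

/-! ### Immersions of manifolds, read in a chart -/

namespace Submfd

open CoordGeom RiemGeom

variable {n : ℕ} {M : Type*} [TopologicalSpace M] [ChartedSpace (EuclideanSpace ℝ (Fin n)) M]
  [IsManifold (𝓡 n) ∞ M]
  {F : Type*} [NormedAddCommGroup F] [InnerProductSpace ℝ F]
  {x : M → F} {p : M} {u : EuclideanSpace ℝ (Fin n)}

theorem contMDiffAt_extChartAt_symm (hu : u ∈ (extChartAt (𝓡 n) p).target) :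
    ContMDiffAt (𝓡 n) (𝓡 n) ∞ (extChartAt (𝓡 n) p).symm u :=
  (contMDiffOn_extChartAt_symm p).contMDiffAt ((isOpen_extChartAt_target p).mem_nhds hu)

theorem fderiv_comp_extChartAt_symm (hx : IsSmoothImmersion n x)
    (hu : u ∈ (extChartAt (𝓡 n) p).target) (y : EuclideanSpace ℝ (Fin n)) :
    fderiv ℝ (x ∘ (extChartAt (𝓡 n) p).symm) u y
      = differential x ((extChartAt (𝓡 n) p).symm u)
          (mfderiv (𝓡 n) (𝓡 n) (extChartAt (𝓡 n) p).symm u y) := by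
  rw [← mfderiv_eq_fderiv, mfderiv_comp u (hx.smooth.mdifferentiableAt (by simp))
    ((contMDiffAt_extChartAt_symm hu).mdifferentiableAt (by simp))]
  rfl

theorem mfderiv_extChartAt_symm_mfderiv_extChartAt
    (hu : u ∈ (extChartAt (𝓡 n) p).target) (v : TangentSpace (𝓡 n) ((extChartAt (𝓡 n) p).symm u)) :
    mfderiv (𝓡 n) (𝓡 n) (extChartAt (𝓡 n) p).symm u
      (mfderiv (𝓡 n) (𝓡 n) (extChartAt (𝓡 n) p) ((extChartAt (𝓡 n) p).symm u) v) = v := by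
  have : IsManifold (𝓡 n) 1 M := IsManifold.of_le (n := ∞) (by norm_cast)
  have h := mfderivWithin_extChartAt_symm_comp_mfderiv_extChartAt (I := 𝓡 n) hu
  rw [ModelWithCorners.range_eq_univ, mfderivWithin_univ] at h
  exact DFunLike.congr_fun h v

theorem mfderiv_extChartAt_mfderiv_extChartAt_symm
    (hu : u ∈ (extChartAt (𝓡 n) p).target) (y : EuclideanSpace ℝ (Fin n)) :
    mfderiv (𝓡 n) (𝓡 n) (extChartAt (𝓡 n) p) ((extChartAt (𝓡 n) p).symm u)
      (mfderiv (𝓡 n) (𝓡 n) (extChartAt (𝓡 n) p).symm u y) = y := by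
  have : IsManifold (𝓡 n) 1 M := IsManifold.of_le (n := ∞) (by norm_cast)
  have h := mfderiv_extChartAt_comp_mfderivWithin_extChartAt_symm (I := 𝓡 n) hu
  rw [ModelWithCorners.range_eq_univ, mfderivWithin_univ] at h
  exact DFunLike.congr_fun h y

theorem isImmersedPatch (hx : IsSmoothImmersion n x) (p : M) :
    IsImmersedPatch (x ∘ (extChartAt (𝓡 n) p).symm) (metricCoeff (inducedMetric x) p)
      (extChartAt (𝓡 n) p).target where
  isOpen := isOpen_extChartAt_target p
  contDiffOn := contMDiffOn_iff_contDiffOn.1 <|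
    hx.smooth.comp_contMDiffOn (contMDiffOn_extChartAt_symm p)
  linearIndependent u hu := by
    have hinj : Function.Injective (fderiv ℝ (x ∘ (extChartAt (𝓡 n) p).symm) u) := by
      intro y z hyz
      rw [fderiv_comp_extChartAt_symm hx hu, fderiv_comp_extChartAt_symm hx hu] at hyz
      rw [← mfderiv_extChartAt_mfderiv_extChartAt_symm hu y, hx.injective_differential _ hyz,
        mfderiv_extChartAt_mfderiv_extChartAt_symm hu]
    have hb := (EuclideanSpace.basisFun (Fin n) ℝ).toBasis.linearIndependent.map'
      (fderiv ℝ (x ∘ (extChartAt (𝓡 n) p).symm) u).toLinearMap (LinearMap.ker_eq_bot.2 hinj)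
    have hframe : (fun i => partialD i (x ∘ (extChartAt (𝓡 n) p).symm) u)
        = (fderiv ℝ (x ∘ (extChartAt (𝓡 n) p).symm) u).toLinearMap
          ∘ (EuclideanSpace.basisFun (Fin n) ℝ).toBasis := by
      funext i
      simp [partialD]
    rw [hframe]
    exact hb
  metric u hu i j := by
    simp only [partialD, fderiv_comp_extChartAt_symm hx hu]
    rfl

theorem mem_range_differential_iff (hx : IsSmoothImmersion n x)
    (hu : u ∈ (extChartAt (𝓡 n) p).target) (y : F) :
    y ∈ LinearMap.range (differential (n := n) x ((extChartAt (𝓡 n) p).symm u)).toLinearMap ↔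
      ∃ c, fderiv ℝ (x ∘ (extChartAt (𝓡 n) p).symm) u c = y := by
  constructor
  · rintro ⟨v, rfl⟩
    exact ⟨_, (fderiv_comp_extChartAt_symm hx hu _).trans
      (congrArg _ (mfderiv_extChartAt_symm_mfderiv_extChartAt hu v))⟩
  · rintro ⟨c, rfl⟩
    exact ⟨_, (fderiv_comp_extChartAt_symm hx hu c).symm⟩

/-- In the chart at `p`, the components of `x^⊤` are those of the tangential part of the position
vector with respect to the frame `∂ₖφ`. -/
theorem sum_fieldCoeff_smul_partialD (hx : IsSmoothImmersion n x)
    (hu : u ∈ (extChartAt (𝓡 n) p).target) :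
    ∑ k, fieldCoeff (tangentPart x) p u k • partialD k (x ∘ (extChartAt (𝓡 n) p).symm) u
      = tangentProj (n := n) x ((extChartAt (𝓡 n) p).symm u)
          (x ((extChartAt (𝓡 n) p).symm u)) := by
  rw [← fderiv_eq_sum_partialD, fderiv_comp_extChartAt_symm hx hu, fieldCoeff, coords,
    mfderiv_extChartAt_symm_mfderiv_extChartAt hu]
  obtain ⟨a, ha⟩ := Submodule.starProjection_apply_mem (LinearMap.range
    (differential (n := n) x ((extChartAt (𝓡 n) p).symm u)).toLinearMap)
    (x ((extChartAt (𝓡 n) p).symm u))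
  exact Function.invFun_eq ⟨a, ha⟩

theorem inner_sub_tangentProj_partialD (hx : IsSmoothImmersion n x)
    (hu : u ∈ (extChartAt (𝓡 n) p).target) (y : F) (j : Fin n) :
    inner ℝ (y - tangentProj (n := n) x ((extChartAt (𝓡 n) p).symm u) y)
      (partialD j (x ∘ (extChartAt (𝓡 n) p).symm) u) = 0 :=
  Submodule.starProjection_inner_eq_zero _ _
    ((mem_range_differential_iff hx hu _).2 ⟨_, rfl⟩)

/-- The orthogonal projection in `secondFF` and the Christoffel symbols in `hessNormal` compute the
same normal vector. -/
theorem secondFF_eq_hessNormal (hx : IsSmoothImmersion n x) (p : M) (i j : Fin n) :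
    secondFF x p i j = hessNormal (x ∘ (extChartAt (𝓡 n) p).symm)
      (metricCoeff (inducedMetric x) p) i j (extChartAt (𝓡 n) p p) := by
  have hu := mem_extChartAt_target (I := 𝓡 n) p
  have hp : (extChartAt (𝓡 n) p).symm (extChartAt (𝓡 n) p p) = p := extChartAt_to_inv p
  have hr := mem_range_differential_iff hx hu
  rw [hp] at hr
  rw [secondFF, normalProj, tangentProj, hessNormal]
  congr 1
  refine Submodule.eq_starProjection_of_mem_of_inner_eq_zero ?_ ?_
  · exact Submodule.sum_mem _ fun k _ => Submodule.smul_mem _ _ ((hr _).2 ⟨_, rfl⟩)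
  · intro w hw
    obtain ⟨c, rfl⟩ := (hr w).1 hw
    rw [fderiv_eq_sum_partialD, inner_sum]
    refine Finset.sum_eq_zero fun k _ => ?_
    rw [real_inner_smul_right]
    exact mul_eq_zero_of_right _ ((isImmersedPatch hx p).inner_hessNormal hu i j k)

theorem inducedMetric_eq_sum (hx : IsSmoothImmersion n x) (p : M) (v : TangentSpace (𝓡 n) p) :
    inducedMetric x p v v = ∑ i, ∑ j, metricCoeff (inducedMetric x) p (extChartAt (𝓡 n) p p) i j
      * coords p p v i * coords p p v j := by
  have hu := mem_extChartAt_target (I := 𝓡 n) p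
  have hv : differential x p v
      = ∑ i, coords p p v i •
          partialD i (x ∘ (extChartAt (𝓡 n) p).symm) (extChartAt (𝓡 n) p p) := by
    -- Stated for every `q` equal to the image of the centre of the chart, so that the type of `v`
    -- can be rewritten.
    have h : ∀ q : M, (extChartAt (𝓡 n) p).symm (extChartAt (𝓡 n) p p) = q →
        ∀ w : TangentSpace (𝓡 n) q, differential x q w
          = fderiv ℝ (x ∘ (extChartAt (𝓡 n) p).symm) (extChartAt (𝓡 n) p p) (coords p q w) := by
      rintro q rfl w
      rw [fderiv_comp_extChartAt_symm hx hu, coords, mfderiv_extChartAt_symm_mfderiv_extChartAt hu]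
    rw [h p (extChartAt_to_inv p), fderiv_eq_sum_partialD]
  rw [inducedMetric, hv, sum_inner]
  refine Finset.sum_congr rfl fun i _ => ?_
  rw [inner_sum]
  refine Finset.sum_congr rfl fun j _ => ?_
  rw [real_inner_smul_left, real_inner_smul_right, (isImmersedPatch hx p).metric _ hu]
  ring

theorem neg_mul_inducedMetric_le_bakryEmeryRicci (hx : IsSmoothImmersion n x)
    (hexp : IsSelfExpander n x) (p : M) (v : TangentSpace (𝓡 n) p) :
    -(normSqSecondFF n x p + 1) * inducedMetric x p v v
      ≤ bakryEmeryRicci (inducedMetric x) (tangentPart x) p v v := by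
  have hu := mem_extChartAt_target (I := 𝓡 n) p
  have hp : (extChartAt (𝓡 n) p).symm (extChartAt (𝓡 n) p p) = p := extChartAt_to_inv p
  have hT := sum_fieldCoeff_smul_partialD hx hu
  rw [hp] at hT
  have hH := hexp p
  simp only [meanCurvature, secondFF_eq_hessNormal hx, inverseMetric, normalProj] at hH
  rw [inducedMetric_eq_sum hx p v]
  simp only [normSqSecondFF, secondFF_eq_hessNormal hx, inverseMetric]
  refine (isImmersedPatch hx p).neg_mul_le_ricci_sub_lieDerivMetric
    (V := fieldCoeff (tangentPart x) p) (fun w hw j => ?_) hu ?_ _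
  · rw [sum_fieldCoeff_smul_partialD hx hw]
    exact inner_sub_tangentProj_partialD hx hw _ j
  · rw [hT, hH, Function.comp_apply, hp]

end Submfd

theorem proposition3p1 {n : ℕ} {M : Type*} [TopologicalSpace M] [T2Space M]
    [SecondCountableTopology M]
    [ChartedSpace (EuclideanSpace ℝ (Fin n)) M] [IsManifold (𝓡 n) ∞ M]
    (x : M → EuclideanSpace ℂ (Fin n))
    (hx : Submfd.IsSmoothImmersion n x)
    (hexp : Submfd.IsSelfExpander n x)
    (hcomplete : RiemGeom.IsCompleteMetric (n := n) (Submfd.inducedMetric x))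
    (S : ℝ) (hS : ∀ p : M, Submfd.normSqSecondFF n x p = S)
    (p : M) (v : TangentSpace (𝓡 n) p) :
    -(S + 1) * Submfd.inducedMetric x p v v ≤
      RiemGeom.bakryEmeryRicci (Submfd.inducedMetric x) (Submfd.tangentPart x) p v v := by
  rw [← hS p]
  exact Submfd.neg_mul_inducedMetric_le_bakryEmeryRicci hx hexp p v
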